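/- For every dimension $n\ge 2$ there is a constant $C_n>0$, depending only on $n$, such that for every $N\ge 1$ and any $N$ points $x_1,\dots,x_N\in\mathbb{H}^n\cup\partial_\infty\mathbb{H}^n$ (each of them a point of hyperbolic $n$-space or a point at infinity), $$\operatorname{Vol}\bigl(\operatorname{conv}(x_1,\dots,x_N)\cap\mathbb{H}^n\bigr)<C_n N .$$ Here $\operatorname{conv}$ is the hyperbolic convex hull, that is, the smallest subset of $\mathbb{H}^n\cup\partial_\infty\mathbb{H}^n$ that contains the given points and, with any two of its points, the geodesic segment, ray or line joining them; $\operatorname{Vol}$ is the hyperbolic (Riemannian) volume. -/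

import Mathlib

open MeasureTheory

/-- The Klein model of hyperbolic `n`-space: the open Euclidean unit ball. -/
def kleinBall (n : ℕ) : Set (EuclideanSpace ℝ (Fin n)) := Metric.ball 0 1

/-- Hyperbolic space together with its points at infinity: the closed Euclidean unit ball. -/
def kleinClosedBall (n : ℕ) : Set (EuclideanSpace ℝ (Fin n)) := Metric.closedBall 0 1

/-- The Riemannian metric of the Klein model at the point `x`, as the matrix of the quadratic form
`|dx|² / (1 - |x|²) + (∑ xᵢ dxᵢ)² / (1 - |x|²)²` in the standard coordinates. -/
noncomputable def kleinMetric {n : ℕ} (x : EuclideanSpace ℝ (Fin n)) :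
    Matrix (Fin n) (Fin n) ℝ :=
  Matrix.of fun i j =>
    (if i = j then 1 else 0) / (1 - ‖x‖ ^ 2) + x i * x j / (1 - ‖x‖ ^ 2) ^ 2

/-- Hyperbolic volume: the Riemannian volume `√(det g) dx` of the Klein metric on the unit ball
(points at infinity carry no mass). -/
noncomputable def hypVolume (n : ℕ) : Measure (EuclideanSpace ℝ (Fin n)) :=
  (volume.restrict (kleinBall n)).withDensity
    fun x => ENNReal.ofReal (√(kleinMetric x).det)

/-- The hyperbolic distance in the Klein model (meaningful for `x`, `y` in the open unit ball):
`cosh d(x, y) = (1 - ⟨x, y⟩) / √((1 - |x|²) (1 - |y|²))`. -/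
noncomputable def hypDist {n : ℕ} (x y : EuclideanSpace ℝ (Fin n)) : ℝ :=
  Real.arcosh ((1 - inner ℝ x y) / √((1 - ‖x‖ ^ 2) * (1 - ‖y‖ ^ 2)))

/-- A complete hyperbolic geodesic, parametrized by arc length, together with its two endpoints
at infinity: an isometric embedding of the real line into hyperbolic space, extended continuously
to `[-∞, +∞]`. -/
structure IsGeodesicLine {n : ℕ} (γ : EReal → EuclideanSpace ℝ (Fin n)) : Prop where
  continuous : Continuous γ
  mem_kleinBall : ∀ t : ℝ, γ t ∈ kleinBall n
  hypDist_eq : ∀ s t : ℝ, hypDist (γ s) (γ t) = |s - t|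

/-- A set of points of hyperbolic space and of points at infinity is (geodesically) convex if it
contains, with any two of its points, the geodesic arc (segment, ray or line) that joins them. -/
def IsHypConvex {n : ℕ} (K : Set (EuclideanSpace ℝ (Fin n))) : Prop :=
  K ⊆ kleinClosedBall n ∧
    ∀ γ : EReal → EuclideanSpace ℝ (Fin n), IsGeodesicLine γ →
      ∀ a t b : EReal, a ≤ t → t ≤ b → γ a ∈ K → γ b ∈ K → γ t ∈ K

/-- The hyperbolic convex hull of a set of points, some of which may lie at infinity: the smallest
convex set that contains them. -/
def hypConvexHull {n : ℕ} (V : Set (EuclideanSpace ℝ (Fin n))) :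
    Set (EuclideanSpace ℝ (Fin n)) :=
  ⋂₀ {K | IsHypConvex K ∧ V ⊆ K}

/-! In the Klein model geodesics are straight, so the hull lies in a Euclidean polytope `K`; adding
the points ±eᵢ puts the origin in its interior and costs only `2 * n` vertices. It then suffices to
charge a bounded volume to each vertex.

By Carathéodory, a boundary point of `K` has some barycentric weight at least `1 / (n + 1)`, at a
vertex `x` say. It is thus `(1 - r) • x + r • q` with `q ∈ K` and `r = n / (n + 1)`, and its chord
`[x, q]` lies in a supporting hyperplane. Coning such points to the origin gives one wedge per
vertex, and the wedges cover `K` (`convexHull_subset_iUnion_wedge`).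

In each half-plane bounded by the line through `0` and `x`, the supporting hyperplanes force all
these chords onto one ray from `x` (`NonCrossing`). With `u` the distance to that line and `qu` its
value at the far end of the ray in the unit ball, a point at depth `δ` below the ray satisfies `1 -
‖p‖ ^ 2 ≥ δ + c * u * qu`, since it stays away from the far end (`NonCrossing.exists_slice_bound`).
Integrating the density over `δ`, then over `u ≤ qu`, gives a bound in which `qu` cancels;
integrating over the directions of half-planes bounds the wedge. -/

/-! ### Geodesics of the Klein model are straight -/

section Geodesics

variable {E : Type*} [NormedAddCommGroup E] [InnerProductSpace ℝ E]

/-- Reverse Cauchy–Schwarz for timelike vectors: the argument of `arcosh` in `hypDist` is at least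
1, so `cosh` inverts it. -/
theorem one_sub_inner_ge_sqrt {x y : E} (hx : ‖x‖ < 1) (hy : ‖y‖ < 1) :
    √((1 - ‖x‖ ^ 2) * (1 - ‖y‖ ^ 2)) ≤ 1 - inner ℝ x y := by
  have h := real_inner_le_norm x y
  have hxy : ‖x‖ * ‖y‖ < 1 := by nlinarith [norm_nonneg x, norm_nonneg y]
  refine (Real.sqrt_le_sqrt (y := (1 - ‖x‖ * ‖y‖) ^ 2) ?_).trans ?_
  · nlinarith [sq_nonneg (‖x‖ - ‖y‖)]
  · rw [Real.sqrt_sq (by linarith)]; linarith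

/-- A Lorentz-null vector orthogonal to a timelike vector vanishes. -/
theorem eq_zero_of_null_of_orthogonal {y v : E} {τ : ℝ} (hy : ‖y‖ < 1)
    (h₁ : τ = inner ℝ y v) (h₂ : τ ^ 2 = ‖v‖ ^ 2) : v = 0 := by
  by_contra hv
  have hv : 0 < ‖v‖ := norm_pos_iff.2 hv
  have h := abs_real_inner_le_norm y v
  rw [← h₁, (sq_eq_sq_iff_abs_eq_abs _ _).1 h₂, abs_norm] at h
  nlinarith

/-- Equality in the triangle inequality of the Klein model, in terms of `cosh` of the distances. -/
theorem mem_segment_of_klein_cosh {x y z : E} (hx : ‖x‖ < 1) (hy : ‖y‖ < 1) (hz : ‖z‖ < 1)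
    {α β : ℝ} (hα : 0 < α) (hβ : 0 < β)
    (hxy : 1 - inner ℝ x y = Real.cosh α * (√(1 - ‖x‖ ^ 2) * √(1 - ‖y‖ ^ 2)))
    (hyz : 1 - inner ℝ y z = Real.cosh β * (√(1 - ‖y‖ ^ 2) * √(1 - ‖z‖ ^ 2)))
    (hxz : 1 - inner ℝ x z = Real.cosh (α + β) * (√(1 - ‖x‖ ^ 2) * √(1 - ‖z‖ ^ 2))) :
    y ∈ segment ℝ x z := by
  have key : ∀ w : E, ‖w‖ < 1 → 0 < √(1 - ‖w‖ ^ 2) ∧ ‖w‖ ^ 2 = 1 - √(1 - ‖w‖ ^ 2) ^ 2 := by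
    intro w hw
    have : 0 < 1 - ‖w‖ ^ 2 := by nlinarith [norm_nonneg w]
    exact ⟨Real.sqrt_pos.2 this, by rw [Real.sq_sqrt this.le]; ring⟩
  obtain ⟨hA, hx2⟩ := key x hx
  obtain ⟨hB, hy2⟩ := key y hy
  obtain ⟨hD, hz2⟩ := key z hz
  generalize √(1 - ‖x‖ ^ 2) = A at *
  generalize √(1 - ‖y‖ ^ 2) = B at *
  generalize √(1 - ‖z‖ ^ 2) = D at *
  have hsα := Real.sinh_pos_iff.2 hα
  have hsβ := Real.sinh_pos_iff.2 hβ
  have hcα := Real.cosh_sq α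
  have hcβ := Real.cosh_sq β
  have hs : 0 < Real.sinh (α + β) := Real.sinh_pos_iff.2 (by linarith)
  have hS := Real.sinh_add α β
  have hC := Real.cosh_add α β
  rw [hC] at hxz
  set S := Real.sinh (α + β)
  set a := Real.sinh α
  set b := Real.sinh β
  set p := Real.cosh α
  set q := Real.cosh β
  have hxy' : inner ℝ x y = 1 - p * (A * B) := by linarith
  have hyz' : inner ℝ y z = 1 - q * (B * D) := by linarith
  have hxz' : inner ℝ x z = 1 - (p * q + a * b) * (A * D) := by linarith
  -- On the hyperboloid, with lifts `X = (x, 1) / A` and so on, collinearity reads `sinh (α + β) Y =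
  -- sinh β X + sinh α Z`. The pair `(v, τ)` is the difference of the two sides times `A * B * D`;
  -- it is null and orthogonal to `Y`, hence zero.
  set v : E := (S * A * D) • y - (b * B * D) • x - (a * A * B) • z with hv
  set τ : ℝ := S * A * D - b * B * D - a * A * B with hτ
  have hv0 : v = 0 := by
    refine eq_zero_of_null_of_orthogonal (τ := τ) hy ?_ ?_
    · rw [hv, inner_sub_right, inner_sub_right, inner_smul_right, inner_smul_right,
        inner_smul_right, real_inner_self_eq_norm_sq, real_inner_comm x y, hxy', hyz', hy2, hτ, hS]
      ring
    · rw [← real_inner_self_eq_norm_sq, hv]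
      simp only [inner_sub_right, inner_sub_left, inner_smul_right, inner_smul_left,
        real_inner_self_eq_norm_sq, real_inner_comm x y, real_inner_comm x z,
        real_inner_comm y z, hxy', hyz', hxz', hx2, hy2, hz2, hS, conj_trivial]
      rw [hτ, hS]
      linear_combination -(A * B * D) ^ 2 * (a ^ 2 * hcβ + b ^ 2 * hcα)
  have hτ0 : τ = 0 := by
    have h : τ = inner ℝ y v := by
      rw [hv, inner_sub_right, inner_sub_right, inner_smul_right, inner_smul_right,
        inner_smul_right, real_inner_self_eq_norm_sq, real_inner_comm x y, hxy', hyz', hy2, hτ, hS]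
      ring
    rw [h, hv0, inner_zero_right]
  have hSAD : 0 < S * A * D := by positivity
  refine ⟨b * B * D / (S * A * D), a * A * B / (S * A * D), by positivity, by positivity, ?_, ?_⟩
  · rw [← add_div, div_eq_one_iff_eq hSAD.ne']; linarith
  · have : (S * A * D) • y = (b * B * D) • x + (a * A * B) • z := by
      rw [← sub_eq_zero, ← hv0, hv]; abel
    rw [div_eq_inv_mul, div_eq_inv_mul, mul_smul _ (b * B * D), mul_smul _ (a * A * B),
      ← smul_add, ← this, smul_smul, inv_mul_cancel₀ hSAD.ne', one_smul]

end Geodesics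

theorem IsGeodesicLine.mem_segment_real {n : ℕ} {γ : EReal → EuclideanSpace ℝ (Fin n)}
    (hγ : IsGeodesicLine γ) {a t b : ℝ} (hat : a < t) (htb : t < b) :
    γ t ∈ segment ℝ (γ a) (γ b) := by
  have hn : ∀ s : ℝ, ‖γ s‖ < 1 := fun s => by simpa [kleinBall] using hγ.mem_kleinBall s
  have key : ∀ s u : ℝ, s < u → 1 - inner ℝ (γ s) (γ u) =
      Real.cosh (u - s) * (√(1 - ‖γ s‖ ^ 2) * √(1 - ‖γ u‖ ^ 2)) := by
    intro s u hsu
    have hs : 0 < 1 - ‖γ s‖ ^ 2 := by nlinarith [norm_nonneg (γ s), hn s]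
    have hu : 0 < 1 - ‖γ u‖ ^ 2 := by nlinarith [norm_nonneg (γ u), hn u]
    have hp : 0 < √((1 - ‖γ s‖ ^ 2) * (1 - ‖γ u‖ ^ 2)) := Real.sqrt_pos.2 (mul_pos hs hu)
    have h := hγ.hypDist_eq s u
    rw [hypDist, abs_sub_comm, abs_of_pos (sub_pos.2 hsu)] at h
    rw [← h, Real.cosh_arcosh ((one_le_div hp).2 (one_sub_inner_ge_sqrt (hn s) (hn u))),
      ← Real.sqrt_mul hs.le, div_mul_cancel₀ _ hp.ne']
  refine mem_segment_of_klein_cosh (hn a) (hn t) (hn b) (sub_pos.2 hat) (sub_pos.2 htb)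
    (key _ _ hat) (key _ _ htb) ?_
  rw [key _ _ (hat.trans htb), sub_add_sub_comm, add_comm t b, add_sub_add_right_eq_sub]

/-- Betweenness is an equality of Euclidean distances, so it passes to the limit at the ideal
endpoints. -/
theorem IsGeodesicLine.mem_segment {n : ℕ} {γ : EReal → EuclideanSpace ℝ (Fin n)}
    (hγ : IsGeodesicLine γ) {a t b : EReal} (hat : a ≤ t) (htb : t ≤ b) :
    γ t ∈ segment ℝ (γ a) (γ b) := by
  rcases hat.eq_or_lt with rfl | hat
  · exact left_mem_segment _ _ _
  rcases htb.eq_or_lt with rfl | htb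
  · exact right_mem_segment _ _ _
  lift t to ℝ using ⟨(htb.trans_le le_top).ne, (bot_le.trans_lt hat).ne'⟩
  have hreal : ∀ c d : ℝ, c < t → t < d → dist (γ c) (γ t) + dist (γ t) (γ d) = dist (γ c) (γ d) :=
    fun c d hc hd => dist_add_dist_eq_iff.2 (mem_segment_iff_wbtw.1 (hγ.mem_segment_real hc hd))
  have hright : ∀ c : ℝ, c < t → dist (γ c) (γ t) + dist (γ t) (γ b) = dist (γ c) (γ b) := by
    intro c hc
    induction b with
    | bot => simp at htb
    | coe d => exact hreal c d hc (by exact_mod_cast htb)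
    | top =>
      have hlim : Filter.Tendsto (fun d : ℝ => γ d) Filter.atTop (nhds (γ ⊤)) :=
        (hγ.continuous.tendsto _).comp EReal.tendsto_coe_atTop
      refine tendsto_nhds_unique_of_eventuallyEq (tendsto_const_nhds.add
        (tendsto_const_nhds.dist hlim)) (tendsto_const_nhds.dist hlim) ?_
      filter_upwards [Filter.eventually_gt_atTop t] with d hd using hreal c d hc hd
  rw [mem_segment_iff_wbtw, ← dist_add_dist_eq_iff]
  induction a with
  | top => simp at hat
  | coe c => exact hright c (by exact_mod_cast hat)
  | bot =>
    have hlim : Filter.Tendsto (fun d : ℝ => γ d) Filter.atBot (nhds (γ ⊥)) :=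
      (hγ.continuous.tendsto _).comp EReal.tendsto_coe_atBot
    refine tendsto_nhds_unique_of_eventuallyEq ((hlim.dist tendsto_const_nhds).add
      tendsto_const_nhds) (hlim.dist tendsto_const_nhds) ?_
    filter_upwards [Filter.eventually_lt_atBot t] with c hc using hright c hc

theorem hypConvexHull_subset_convexHull {n : ℕ} {V : Set (EuclideanSpace ℝ (Fin n))}
    (hV : V ⊆ kleinClosedBall n) : hypConvexHull V ⊆ convexHull ℝ V :=
  Set.sInter_subset_of_mem ⟨⟨convexHull_min hV (convex_closedBall _ _),
    fun _ hγ _ _ _ hat htb ha hb =>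
      (convex_convexHull ℝ V).segment_subset ha hb (hγ.mem_segment hat htb)⟩,
    subset_convexHull ℝ V⟩

/-! ### The volume density of the Klein model -/

theorem det_kleinMetric {n : ℕ} {x : EuclideanSpace ℝ (Fin n)} (hx : ‖x‖ < 1) :
    (kleinMetric x).det = ((1 - ‖x‖ ^ 2) ^ (n + 1))⁻¹ := by
  have hd : 0 < 1 - ‖x‖ ^ 2 := by nlinarith [norm_nonneg x]
  have h : kleinMetric x = (1 - ‖x‖ ^ 2)⁻¹ • (1 + Matrix.replicateCol Unit (fun i => x i) *
      Matrix.replicateRow Unit (fun i => x i / (1 - ‖x‖ ^ 2))) := by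
    ext i j
    simp [kleinMetric, Matrix.one_apply, Matrix.mul_apply]
    field_simp
  rw [h, Matrix.det_smul, Matrix.det_one_add_replicateCol_mul_replicateRow]
  have h2 : (fun i => x i / (1 - ‖x‖ ^ 2)) ⬝ᵥ (fun i => x i) = ‖x‖ ^ 2 / (1 - ‖x‖ ^ 2) := by
    rw [EuclideanSpace.real_norm_sq_eq, dotProduct, Finset.sum_div]
    exact Finset.sum_congr rfl fun i _ => by ring
  rw [h2, Fintype.card_fin, one_add_div hd.ne', sub_add_cancel, one_div, ← pow_succ, inv_pow]

theorem sqrt_det_kleinMetric {n : ℕ} {x : EuclideanSpace ℝ (Fin n)} (hx : ‖x‖ < 1) :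
    √(kleinMetric x).det = (1 - ‖x‖ ^ 2) ^ (-((n + 1 : ℝ) / 2)) := by
  have hd : 0 < 1 - ‖x‖ ^ 2 := by nlinarith [norm_nonneg x]
  rw [det_kleinMetric hx, Real.sqrt_eq_rpow, ← Real.rpow_natCast, ← Real.rpow_neg hd.le,
    ← Real.rpow_mul hd.le]
  congr 1
  push_cast
  ring

theorem hypVolume_apply {n : ℕ} {s : Set (EuclideanSpace ℝ (Fin n))} (hs : MeasurableSet s) :
    hypVolume n s = ∫⁻ x in s ∩ Metric.ball 0 1,
      ENNReal.ofReal ((1 - ‖x‖ ^ 2) ^ (-((n + 1 : ℝ) / 2))) := by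
  rw [hypVolume, withDensity_apply', Measure.restrict_restrict hs]
  refine setLIntegral_congr_fun (hs.inter measurableSet_ball) fun x hx => ?_
  have hx1 : ‖x‖ < 1 := by simpa [kleinBall] using hx.2
  simp only [sqrt_det_kleinMetric hx1]

/-! ### Polar coordinates and two power integrals -/

section Integrals

open Set Module

/-- A bound in polar coordinates: if the integrals along all rays are at most `C`, the integral is
at most `C` times the area of the unit sphere. -/
theorem lintegral_le_mul_toSphere {F : Type*} [NormedAddCommGroup F] [NormedSpace ℝ F]
    [FiniteDimensional ℝ F] [MeasurableSpace F] [BorelSpace F] (μ : Measure F)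
    [Nontrivial F] [μ.IsAddHaarMeasure] {G : F → ENNReal} (hG : Measurable G) {C : ENNReal}
    (h : ∀ η : F, ‖η‖ = 1 →
      ∫⁻ u in Ioi (0 : ℝ), ENNReal.ofReal (u ^ (finrank ℝ F - 1)) * G (u • η) ≤ C) :
    ∫⁻ w, G w ∂μ ≤ C * μ.toSphere univ := by
  have hmp := μ.measurePreserving_homeomorphUnitSphereProd
  have hemb := (homeomorphUnitSphereProd F).measurableEmbedding
  have h1 : ∫⁻ w, G w ∂μ = ∫⁻ w : ({0}ᶜ : Set F), G w ∂(μ.comap (↑)) := by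
    rw [lintegral_subtype_comap (measurableSet_singleton _).compl, restrict_compl_singleton]
  have h2 : ∫⁻ w : ({0}ᶜ : Set F), G w ∂(μ.comap (↑)) =
      ∫⁻ z, G ((z.2 : ℝ) • (z.1 : F))
        ∂(μ.toSphere.prod (Measure.volumeIoiPow (finrank ℝ F - 1))) := by
    rw [← hmp.lintegral_comp_emb hemb]
    refine lintegral_congr fun w => ?_
    have hw : ‖(w : F)‖ ≠ 0 := norm_ne_zero_iff.2 w.2
    simp [smul_smul, hw]
  rw [h1, h2]
  have hmeas : Measurable fun z : (Metric.sphere (0 : F) 1) × (Ioi (0 : ℝ)) =>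
      G ((z.2 : ℝ) • (z.1 : F)) := by fun_prop
  rw [lintegral_prod _ hmeas.aemeasurable, ← lintegral_const]
  refine lintegral_mono fun η => ?_
  refine le_trans (le_of_eq ?_) (h η (by simp))
  rw [Measure.volumeIoiPow, lintegral_withDensity_eq_lintegral_mul _ (by fun_prop) (by fun_prop),
    ← lintegral_subtype_comap measurableSet_Ioi]
  rfl

theorem lintegral_Iic_rpow_le {m h₀ κ : ℝ} (hm : 0 < m) (hκ : 0 < κ) :
    ∫⁻ h in Iic h₀, ENNReal.ofReal ((h₀ - h + κ) ^ (-((m + 2) / 2))) =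
      ENNReal.ofReal (2 / m * κ ^ (-(m / 2))) := by
  have he : -((m + 2) / 2) < -1 := by linarith
  rw [← lintegral_indicator measurableSet_Iic]
  have h1 : ∀ h : ℝ, (Iic h₀).indicator
      (fun h => ENNReal.ofReal ((h₀ - h + κ) ^ (-((m + 2) / 2)))) h =
      (Ici κ).indicator (fun y => ENNReal.ofReal (y ^ (-((m + 2) / 2)))) (h₀ + κ - h) := by
    intro h
    by_cases hh : h ≤ h₀
    · rw [indicator_of_mem (by exact hh), indicator_of_mem (by rw [mem_Ici]; linarith),
        add_sub_right_comm]
    · rw [indicator_of_notMem (by exact hh), indicator_of_notMem (by rw [mem_Ici]; linarith)]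
  simp_rw [h1]
  rw [lintegral_sub_left_eq_self (μ := volume)
    (fun y => (Ici κ).indicator (fun y => ENNReal.ofReal (y ^ (-((m + 2) / 2)))) y) (h₀ + κ),
    lintegral_indicator measurableSet_Ici, setLIntegral_congr Ioi_ae_eq_Ici.symm,
    ← ofReal_integral_eq_lintegral_ofReal (integrableOn_Ioi_rpow_of_lt he hκ),
    integral_Ioi_rpow_of_lt he hκ]
  · congr 1
    rw [show -((m + 2) / 2) + 1 = -(m / 2) by ring]
    field_simp
  · filter_upwards [ae_restrict_mem measurableSet_Ioi] with y hy
    exact Real.rpow_nonneg (hκ.trans hy).le _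

/-- The integrand scales so that all powers of `q` cancel: the bound does not see the length of the
chord. -/
theorem lintegral_Ioc_pow_mul_rpow {m : ℕ} (hm : 1 ≤ m) {c q : ℝ} (hc : 0 < c) (hq : 0 < q) :
    ∫⁻ u in Ioc 0 q, ENNReal.ofReal (u ^ (m - 1)) *
      ENNReal.ofReal (2 / m * (c * u * q) ^ (-(m / 2 : ℝ))) =
      ENNReal.ofReal ((2 / m) ^ 2 * c ^ (-(m / 2 : ℝ))) := by
  have hm0 : (0 : ℝ) < m := by exact_mod_cast hm
  have h1 : ∀ u ∈ Ioc 0 q, ENNReal.ofReal (u ^ (m - 1)) *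
      ENNReal.ofReal (2 / m * (c * u * q) ^ (-(m / 2 : ℝ))) =
      ENNReal.ofReal (2 / m * c ^ (-(m / 2 : ℝ)) * q ^ (-(m / 2 : ℝ)) * u ^ (m / 2 - 1 : ℝ)) := by
    intro u hu
    have hu0 := hu.1
    rw [← ENNReal.ofReal_mul (by positivity)]
    congr 1
    rw [Real.mul_rpow (by positivity) hq.le, Real.mul_rpow hc.le hu0.le, ← Real.rpow_natCast,
      Nat.cast_sub hm, show (m / 2 - 1 : ℝ) = (m - (1 : ℕ) : ℝ) + -(m / 2 : ℝ) by push_cast; ring,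
      Real.rpow_add hu0]
    ring
  have he : (-1 : ℝ) < m / 2 - 1 := by linarith [half_pos hm0]
  have hint : IntervalIntegrable (fun u : ℝ => u ^ (m / 2 - 1 : ℝ)) volume 0 q :=
    intervalIntegral.intervalIntegrable_rpow' he
  rw [setLIntegral_congr_fun measurableSet_Ioc h1, ← ofReal_integral_eq_lintegral_ofReal,
    integral_const_mul, ← intervalIntegral.integral_of_le hq.le, integral_rpow (Or.inl he)]
  · congr 1
    rw [sub_add_cancel, Real.zero_rpow (by positivity), Real.rpow_neg hq.le]
    have := Real.rpow_pos_of_pos hq (m / 2 : ℝ)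
    field_simp
    ring
  · exact (hint.1).const_mul _
  · filter_upwards [ae_restrict_mem measurableSet_Ioc] with u hu
    have := hu.1
    positivity

end Integrals

/-! ### Wedges and the non-crossing condition -/

section Wedge

open Set

variable {E : Type*} [NormedAddCommGroup E] [NormedSpace ℝ E]

/-- The cone with apex the origin over the homothetic image of `Q` with centre `x` and ratio `r`. -/
def wedge (r : ℝ) (x : E) (Q : Set E) : Set E :=
  (fun p : ℝ × E => p.1 • ((1 - r) • x + r • p.2)) '' (Icc 0 1 ×ˢ Q)

/-- No ray from `x` to a point of `Q` lies strictly between the ray from `x` through the origin and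
the ray from `x` to another point of `Q`. -/
def NonCrossing (x : E) (Q : Set E) : Prop :=
  ∀ q₁ ∈ Q, ∀ q₂ ∈ Q, ∀ a b : ℝ, 0 < a → 0 < b → q₂ - x ≠ b • (q₁ - x) - a • x

theorem IsCompact.wedge {r : ℝ} {x : E} {Q : Set E} (hQ : IsCompact Q) :
    IsCompact (wedge r x Q) :=
  (isCompact_Icc.prod hQ).image (by fun_prop)

theorem NonCrossing.image {E' : Type*} [NormedAddCommGroup E'] [NormedSpace ℝ E'] {x : E}
    {Q : Set E} (h : NonCrossing x Q) (φ : E ≃ₗᵢ[ℝ] E') : NonCrossing (φ x) (φ '' Q) := by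
  rintro _ ⟨q₁, h₁, rfl⟩ _ ⟨q₂, h₂, rfl⟩ a b ha hb heq
  refine h q₁ h₁ q₂ h₂ a b ha hb (φ.injective ?_)
  simpa using heq

theorem image_wedge {E' : Type*} [NormedAddCommGroup E'] [NormedSpace ℝ E'] (r : ℝ) (x : E)
    (Q : Set E) (φ : E ≃ₗᵢ[ℝ] E') : φ '' wedge r x Q = wedge r (φ x) (φ '' Q) := by
  ext y
  constructor
  · rintro ⟨_, ⟨⟨t, q⟩, ⟨ht, hq⟩, rfl⟩, rfl⟩
    exact ⟨⟨t, φ q⟩, ⟨ht, q, hq, rfl⟩, by simp⟩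
  · rintro ⟨⟨t, _⟩, ⟨ht, q, hq, rfl⟩, rfl⟩
    exact ⟨_, ⟨⟨t, q⟩, ⟨ht, hq⟩, rfl⟩, by simp⟩

end Wedge

/-! ### A wedge in a half-plane bounded by its axis -/

section Slice

open Set WithLp

variable {F : Type*} [NormedAddCommGroup F] [InnerProductSpace ℝ F]

theorem norm_sq_toLp_smul {η : F} (hη : ‖η‖ = 1) (h u : ℝ) :
    ‖toLp 2 (h, u • η)‖ ^ 2 = h ^ 2 + u ^ 2 := by
  rw [prod_norm_sq_eq_of_L2]
  simp [norm_smul, hη]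

theorem exists_of_mem_wedge {ξ r h u : ℝ} {Q : Set (WithLp 2 (ℝ × F))} {η : F} (hη : ‖η‖ = 1)
    (hu : 0 < u) (hr : 0 < r) (hmem : toLp 2 (h, u • η) ∈ wedge r (toLp 2 (ξ, 0)) Q) :
    ∃ t a v : ℝ, 0 < t ∧ t ≤ 1 ∧ 0 < v ∧ toLp 2 (a, v • η) ∈ Q ∧
      h = t * ((1 - r) * ξ + r * a) ∧ u = t * (r * v) := by
  obtain ⟨⟨t, q⟩, ⟨⟨ht₀, ht₁⟩, hq⟩, heq⟩ := hmem
  have hfst : t * ((1 - r) * ξ + r * q.fst) = h := by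
    simpa [mul_add] using congrArg (fun p : WithLp 2 (ℝ × F) => p.fst) heq
  have hsnd : t • r • q.snd = u • η := by
    simpa using congrArg (fun p : WithLp 2 (ℝ × F) => p.snd) heq
  have hη₀ : η ≠ 0 := by rintro rfl; simp at hη
  have ht : 0 < t := by
    refine ht₀.lt_of_ne fun h0 => ?_
    rw [show t = 0 from h0.symm, zero_smul] at hsnd
    exact smul_ne_zero hu.ne' hη₀ hsnd.symm
  have hqη : q.snd = (u / (t * r)) • η := by
    rw [div_eq_inv_mul, mul_smul, ← hsnd, smul_smul, smul_smul]
    field_simp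
    rw [one_smul]
  refine ⟨t, q.fst, u / (t * r), ht, ht₁, by positivity, ?_, hfst.symm, by field_simp⟩
  rw [← hqη]
  exact hq

/-- The part of a wedge in one half-plane is controlled by a single chord `[x, q]` of the ball. -/
theorem NonCrossing.exists_slice_bound {ξ r : ℝ} (hξ₀ : 0 ≤ ξ) (hξ : ξ ≤ 1) (hr₀ : 0 < r)
    (hr₁ : r < 1) {Q : Set (WithLp 2 (ℝ × F))} (hQ : Q ⊆ Metric.closedBall 0 1)
    (hnc : NonCrossing (toLp 2 (ξ, 0)) Q) {η : F} (hη : ‖η‖ = 1) :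
    ∃ qh qu : ℝ, 0 < qu ∧ ∀ h u : ℝ, 0 < u → toLp 2 (h, u • η) ∈ wedge r (toLp 2 (ξ, 0)) Q →
      1 / 2 ≤ ‖toLp 2 (h, u • η)‖ → u ≤ qu ∧ h ≤ (1 - u / qu) * ξ + u / qu * qh ∧
      ((1 - u / qu) * ξ + u / qu * qh) - h + (1 - r) / 2 * u * qu ≤
        1 - ‖toLp 2 (h, u • η)‖ ^ 2 := by
  by_cases hex : ∃ h u : ℝ, 0 < u ∧ toLp 2 (h, u • η) ∈ wedge r (toLp 2 (ξ, 0)) Q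
  swap
  · exact ⟨0, 1, one_pos, fun h u hu hmem => absurd ⟨h, u, hu, hmem⟩ hex⟩
  obtain ⟨h₁, u₁, hu₁, hmem₁⟩ := hex
  obtain ⟨-, a₁, v₁, -, -, hv₁, hq₁, -, -⟩ := exists_of_mem_wedge hη hu₁ hr₀ hmem₁
  have hball : ∀ a v : ℝ, toLp 2 (a, v • η) ∈ Q → a ^ 2 + v ^ 2 ≤ 1 := by
    intro a v hav
    have := hQ hav
    rw [mem_closedBall_zero_iff] at this
    rw [← norm_sq_toLp_smul hη]
    exact pow_le_one₀ (norm_nonneg _) this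
  have hstep : ∀ a b a₂ v₂ b₂ : ℝ, a₂ - ξ = b * (b₂ - ξ) - a * ξ → ∀ w₂, v₂ = b * w₂ →
      toLp 2 (a₂, v₂ • η) ∈ Q → toLp 2 (b₂, w₂ • η) ∈ Q → 0 < b → ¬ 0 < a := by
    intro a b a₂ v₂ b₂ heq w₂ hv hQ₂ hQ₁ hb ha
    refine hnc _ hQ₁ _ hQ₂ a b ha hb ?_
    rw [← toLp_sub, ← toLp_sub, ← toLp_smul, ← toLp_smul, ← toLp_sub]
    congr 1
    ext1
    · simpa using heq
    · simp [hv, mul_smul]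
  -- If the apex were the origin, `q₁ = q₂` and `a = b = 1` would violate non-crossing.
  have hξpos : 0 < ξ := by
    refine hξ₀.lt_of_ne fun h0 => hstep 1 1 a₁ v₁ a₁ ?_ v₁ ?_ hq₁ hq₁ one_pos one_pos
    · rw [← h0]; ring
    · ring
  -- All of `Q` in this half-plane lies on one ray from `x`: after rescaling to equal `u`, two
  -- points differ by a multiple `c` of `x`, and either sign of `c` is a crossing, with the roles
  -- exchanged.
  have hline : ∀ a v : ℝ, 0 < v → toLp 2 (a, v • η) ∈ Q → a = ξ + v / v₁ * (a₁ - ξ) := by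
    intro a v hv hq
    have hb : 0 < v / v₁ := by positivity
    have hvb : v = v / v₁ * v₁ := by field_simp
    set b := v / v₁
    set c := (b * (a₁ - ξ) - (a - ξ)) / ξ with hc
    have hcξ : c * ξ = b * (a₁ - ξ) - (a - ξ) := by rw [hc]; field_simp
    have h1 := hstep c b a v a₁ (by linarith) v₁ hvb hq hq₁ hb
    have h2 := hstep (-c / b) b⁻¹ a₁ v₁ a (by field_simp; linarith) v
      (by rw [hvb]; field_simp) hq₁ hq (by positivity)
    have hc0 : c = 0 := by
      refine le_antisymm (not_lt.1 h1) (not_lt.1 fun hlt => h2 ?_)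
      exact div_pos (neg_pos.2 hlt) hb
    rw [hc0] at hcξ
    linarith
  -- The ray is prolonged to its last point `(qh, qu)` in the unit disc, which need not belong to
  -- `Q`.
  obtain ⟨S, ⟨hS₀, hSball⟩, hSmax⟩ : ∃ S, IsGreatest
      {s : ℝ | 0 ≤ s ∧ (ξ + s * (a₁ - ξ)) ^ 2 + (s * v₁) ^ 2 ≤ 1} S := by
    refine IsCompact.exists_isGreatest ?_ ⟨1, zero_le_one, ?_⟩
    · refine isCompact_Icc.of_isClosed_subset (s := Icc 0 (1 / v₁)) ?_ ?_
      · have hcont : Continuous fun s : ℝ => (ξ + s * (a₁ - ξ)) ^ 2 + (s * v₁) ^ 2 := by fun_prop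
        exact (isClosed_le continuous_const continuous_id).inter
          (isClosed_le hcont continuous_const)
      · rintro s ⟨hs, hs'⟩
        refine ⟨hs, (le_div_iff₀ hv₁).2 ?_⟩
        nlinarith [sq_nonneg (ξ + s * (a₁ - ξ))]
    · simpa using hball _ _ hq₁
  have hS₁ : 1 ≤ S := hSmax ⟨zero_le_one, by simpa using hball _ _ hq₁⟩
  have hSpos : 0 < S := by linarith
  set qh := ξ + S * (a₁ - ξ)
  refine ⟨qh, S * v₁, by positivity, fun h u hu hmem hnorm => ?_⟩
  obtain ⟨t, a, v, ht₀, ht₁, hv, hq, hh, huv⟩ := exists_of_mem_wedge hη hu hr₀ hmem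
  have ha := hline a v hv hq
  have hbS : v / v₁ ≤ S := hSmax ⟨by positivity, by
    rw [← ha, div_mul_cancel₀ _ hv₁.ne']; exact hball _ _ hq⟩
  set s := r * (v / v₁) / S with hs
  have hs₀ : 0 ≤ s := by positivity
  have hsr : s ≤ r := by
    rw [hs, div_le_iff₀ hSpos]; gcongr
  have hu' : u = t * (s * (S * v₁)) := by rw [huv, hs]; field_simp
  have hh' : h = t * ((1 - s) * ξ + s * qh) := by
    rw [hh, ha, hs]; simp only [qh]; field_simp; ring
  have hqu : 0 < S * v₁ := by positivity
  set qu := S * v₁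
  have hβ : u / qu = t * s := by rw [hu']; field_simp
  have hξ2 : ξ ^ 2 ≤ 1 := by nlinarith
  -- Strict convexity of the squared norm along the chord, keeping only the `qu ^ 2` part of its
  -- squared length.
  have hy : ((1 - s) * ξ + s * qh) ^ 2 + (s * qu) ^ 2 ≤ 1 - s * (1 - s) * qu ^ 2 := by
    have h1 : 0 ≤ s * (1 - (qh ^ 2 + qu ^ 2)) := mul_nonneg hs₀ (by linarith)
    have h2 : 0 ≤ (1 - s) * (1 - ξ ^ 2) := mul_nonneg (by linarith) (by linarith)
    have h3 : 0 ≤ s * (1 - s) * (qh - ξ) ^ 2 :=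
      mul_nonneg (mul_nonneg hs₀ (by linarith)) (sq_nonneg _)
    linarith
  have hp : ‖toLp 2 (h, u • η)‖ ^ 2 ≤ t ^ 2 * (1 - s * (1 - s) * qu ^ 2) := by
    rw [norm_sq_toLp_smul hη, hh', hu', mul_pow, mul_pow, ← mul_add]
    gcongr
  have hs1 : 0 ≤ s * (1 - s) * qu ^ 2 :=
    mul_nonneg (mul_nonneg hs₀ (by linarith)) (sq_nonneg _)
  -- Removing the half-ball serves here: `t` is bounded below, so `t ^ 2` can be traded for `t / 2`
  -- in `h5`.
  have ht : 1 / 2 ≤ t := by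
    have h1 : (1 / 2) ^ 2 ≤ t ^ 2 := by
      refine (pow_le_pow_left₀ (by norm_num) hnorm 2).trans (hp.trans ?_)
      nlinarith [sq_nonneg t]
    exact (sq_le_sq₀ (by norm_num) ht₀.le).1 h1
  rw [hβ]
  refine ⟨?_, ?_, ?_⟩
  · rw [hu']
    calc t * (s * qu) ≤ 1 * (1 * qu) := by gcongr; linarith
      _ = qu := by ring
  · linarith [mul_nonneg (sub_nonneg.2 ht₁) hξ₀]
  · have h4 : (1 - t * s) * ξ + t * s * qh - h ≤ 1 - t := by
      linarith [mul_nonneg (sub_nonneg.2 ht₁) (sub_nonneg.2 hξ)]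
    have h5 : (1 - r) / 2 * u * qu ≤ t ^ 2 * (s * (1 - s) * qu ^ 2) := by
      rw [hu']
      calc (1 - r) / 2 * (t * (s * qu)) * qu = (1 - r) * (t * (1 / 2)) * (s * qu ^ 2) := by ring
        _ ≤ (1 - s) * (t * t) * (s * qu ^ 2) := by gcongr; linarith
        _ = _ := by ring
    have h6 : t ^ 2 ≤ t := by nlinarith
    linarith

end Slice

/-! ### The volume of a wedge -/

section WedgeVolume

open Set WithLp Module

theorem NonCrossing.lintegral_wedge_le_prod {F : Type*} [NormedAddCommGroup F]
    [InnerProductSpace ℝ F] [FiniteDimensional ℝ F] [MeasurableSpace F] [BorelSpace F]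
    {m : ℕ} (hm : 1 ≤ m) (hF : finrank ℝ F = m) {ξ r : ℝ} (hξ₀ : 0 ≤ ξ) (hξ : ξ ≤ 1)
    (hr₀ : 0 < r) (hr₁ : r < 1) {Q : Set (WithLp 2 (ℝ × F))} (hQc : IsCompact Q)
    (hQ : Q ⊆ Metric.closedBall 0 1) (hnc : NonCrossing (toLp 2 (ξ, 0)) Q) :
    ∫⁻ p in (wedge r (toLp 2 (ξ, 0)) Q ∩ (Metric.ball 0 (1 / 2))ᶜ) ∩ Metric.ball 0 1,
      ENNReal.ofReal ((1 - ‖p‖ ^ 2) ^ (-((m + 2 : ℝ) / 2))) ≤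
    ENNReal.ofReal ((2 / m) ^ 2 * ((1 - r) / 2) ^ (-(m / 2 : ℝ))) *
      (volume : Measure F).toSphere univ := by
  have hF0 : Nontrivial F := nontrivial_of_finrank_pos (R := ℝ) (by omega)
  have hm0 : (0 : ℝ) < m := by exact_mod_cast hm
  set A : Set (WithLp 2 (ℝ × F)) :=
    (wedge r (toLp 2 (ξ, 0)) Q ∩ (Metric.ball 0 (1 / 2))ᶜ) ∩ Metric.ball 0 1
  have hA : MeasurableSet A :=
    (hQc.wedge.measurableSet.inter measurableSet_ball.compl).inter measurableSet_ball
  set f : WithLp 2 (ℝ × F) → ENNReal :=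
    A.indicator fun p => ENNReal.ofReal ((1 - ‖p‖ ^ 2) ^ (-((m + 2 : ℝ) / 2))) with hf
  have hfm : Measurable f := Measurable.indicator (by fun_prop) hA
  have hf2 : Measurable fun z : ℝ × F => f (toLp 2 z) :=
    hfm.comp (WithLp.volume_preserving_toLp ℝ F).measurable
  rw [← lintegral_indicator hA, ← hf, ← (WithLp.volume_preserving_toLp ℝ F).lintegral_comp hfm,
    Measure.volume_eq_prod, lintegral_prod_symm' _ hf2]
  refine lintegral_le_mul_toSphere volume hf2.lintegral_prod_left' fun η hη => ?_
  obtain ⟨qh, qu, hqu, hslice⟩ := hnc.exists_slice_bound hξ₀ hξ hr₀ hr₁ hQ hη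
  have hc : 0 < (1 - r) / 2 := by linarith
  rw [hF]
  set g : ℝ → ENNReal := fun u => ENNReal.ofReal (u ^ (m - 1)) *
      ENNReal.ofReal (2 / m * ((1 - r) / 2 * u * qu) ^ (-(m / 2 : ℝ))) with hg
  calc ∫⁻ u in Ioi (0 : ℝ), ENNReal.ofReal (u ^ (m - 1)) * ∫⁻ h, f (toLp 2 (h, u • η))
      ≤ ∫⁻ u in Ioi (0 : ℝ), (Iic qu).indicator g u := by
        refine setLIntegral_mono' measurableSet_Ioi fun u hu => ?_
        rw [mem_Ioi] at hu
        -- The height of the chord over `u`.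
        set h₀ := (1 - u / qu) * ξ + u / qu * qh with hh₀
        have hle : ∀ h, f (toLp 2 (h, u • η)) ≤ (Iic h₀).indicator (fun h => ENNReal.ofReal
            ((h₀ - h + (1 - r) / 2 * u * qu) ^ (-((m + 2 : ℝ) / 2)))) h := by
          intro h
          by_cases hmem : toLp 2 (h, u • η) ∈ A
          · obtain ⟨-, h1, h2⟩ := hslice h u hu hmem.1.1 (by simpa using hmem.1.2)
            rw [hf, indicator_of_mem hmem, indicator_of_mem (by exact h1)]
            have h3 : 0 < h₀ - h + (1 - r) / 2 * u * qu :=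
              add_pos_of_nonneg_of_pos (sub_nonneg.2 h1) (by positivity)
            exact ENNReal.ofReal_le_ofReal
              (Real.rpow_le_rpow_of_nonpos h3 h2 (by linarith))
          · rw [hf, indicator_of_notMem hmem]; exact zero_le
        by_cases huq : u ≤ qu
        · rw [indicator_of_mem (by exact huq)]
          simp only [hg]
          gcongr
          refine (lintegral_mono hle).trans ?_
          rw [lintegral_indicator measurableSet_Iic, lintegral_Iic_rpow_le hm0 (by positivity)]
        · have h0 : ∀ h, f (toLp 2 (h, u • η)) = 0 := fun h =>
            indicator_of_notMem (fun hmem =>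
              huq (hslice h u hu hmem.1.1 (by simpa using hmem.1.2)).1) _
          simp [h0]
    _ = ∫⁻ u in Ioc 0 qu, g u := by
        rw [setLIntegral_indicator measurableSet_Iic, inter_comm, Ioi_inter_Iic]
    _ = _ := lintegral_Ioc_pow_mul_rpow hm hc hqu

theorem exists_linearIsometryEquiv_apply_eq {E E' : Type*} [NormedAddCommGroup E]
    [InnerProductSpace ℝ E] [FiniteDimensional ℝ E] [NormedAddCommGroup E']
    [InnerProductSpace ℝ E'] [FiniteDimensional ℝ E'] (hdim : finrank ℝ E = finrank ℝ E')
    {x : E} {y : E'} (hxy : ‖x‖ = ‖y‖) : ∃ φ : E ≃ₗᵢ[ℝ] E', φ x = y := by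
  let ψ : E ≃ₗᵢ[ℝ] E' := (stdOrthonormalBasis ℝ E).equiv (stdOrthonormalBasis ℝ E') (finCongr hdim)
  refine ⟨ψ.trans (Submodule.reflection (ℝ ∙ (ψ x - y))ᗮ), ?_⟩
  simpa using Submodule.reflection_sub (v := ψ x) (w := y) (by simpa using hxy)

/-- The hyperbolic volume of the part of a non-crossing wedge outside a fixed ball is bounded in
terms of the dimension and the ratio of the wedge. -/
theorem exists_hypVolume_wedge_le {m : ℕ} (hm : 1 ≤ m) {r : ℝ} (hr₀ : 0 < r) (hr₁ : r < 1) :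
    ∃ C : ENNReal, C ≠ ⊤ ∧ ∀ (x : EuclideanSpace ℝ (Fin (m + 1)))
      (Q : Set (EuclideanSpace ℝ (Fin (m + 1)))), ‖x‖ ≤ 1 → IsCompact Q →
      Q ⊆ Metric.closedBall 0 1 → NonCrossing x Q →
      hypVolume (m + 1) (wedge r x Q ∩ (Metric.ball 0 (1 / 2))ᶜ) ≤ C := by
  refine ⟨ENNReal.ofReal ((2 / m) ^ 2 * ((1 - r) / 2) ^ (-(m / 2 : ℝ))) *
      (volume : Measure (EuclideanSpace ℝ (Fin m))).toSphere univ,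
    ENNReal.mul_ne_top ENNReal.ofReal_ne_top (measure_ne_top _ _), ?_⟩
  intro x Q hx hQc hQ hnc
  obtain ⟨φ, hφ⟩ := exists_linearIsometryEquiv_apply_eq
    (E := EuclideanSpace ℝ (Fin (m + 1))) (E' := WithLp 2 (ℝ × EuclideanSpace ℝ (Fin m)))
    (x := x) (y := toLp 2 (‖x‖, 0)) (by
      rw [(WithLp.linearEquiv 2 ℝ (ℝ × EuclideanSpace ℝ (Fin m))).finrank_eq]
      simp [add_comm]) (by simp)
  have hnc' := hnc.image φ
  rw [hφ] at hnc'
  have hQ' : φ '' Q ⊆ Metric.closedBall 0 1 := by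
    rintro _ ⟨q, hq, rfl⟩
    simpa using hQ hq
  refine le_trans (le_of_eq ?_) (hnc'.lintegral_wedge_le_prod hm (by simp) (norm_nonneg x) hx
    hr₀ hr₁ (hQc.image φ.continuous) hQ')
  rw [hypVolume_apply (hQc.wedge.measurableSet.inter measurableSet_ball.compl), ← hφ,
    ← image_wedge, ← φ.measurePreserving.setLIntegral_comp_preimage_emb
      φ.toHomeomorph.measurableEmbedding]
  simp only [preimage_inter, preimage_compl, φ.injective.preimage_image,
    LinearIsometryEquiv.norm_map]
  have hb : ∀ ρ : ℝ, φ ⁻¹' Metric.ball 0 ρ = Metric.ball 0 ρ := by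
    intro ρ; ext z; simp
  rw [hb, hb]
  congr! 5
  push_cast
  ring

end WedgeVolume

/-! ### Covering a polytope by wedges at its vertices -/

section Cover

open Set

variable {E : Type*} [NormedAddCommGroup E] [NormedSpace ℝ E]

/-- The points of `K` whose images under the homothety with centre `x` and ratio `r` are not in the
interior of `K`. -/
def chordSet (K : Set E) (r : ℝ) (x : E) : Set E :=
  {q ∈ K | (1 - r) • x + r • q ∉ interior K}

theorem IsCompact.chordSet {K : Set E} (hK : IsCompact K) (r : ℝ) (x : E) :
    IsCompact (chordSet K r x) := by
  have hcont : Continuous fun q : E => (1 - r) • x + r • q := by fun_prop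
  exact hK.inter_right (isOpen_interior.preimage hcont).isClosed_compl

/-- A functional supporting `K` at `(1 - r) • x + r • q₂` attains its maximum at both `x` and `q₂`,
and this maximum is positive because `0` is interior. It vanishes on `q₂ - x` but is negative on `b
• (q₁ - x) - a • x`. -/
theorem Convex.nonCrossing_chordSet {K : Set E} (hK : Convex ℝ K) (h0 : 0 ∈ interior K) {r : ℝ}
    (hr₀ : 0 < r) (hr₁ : r < 1) {x : E} (hx : x ∈ K) : NonCrossing x (chordSet K r x) := by
  rintro q₁ ⟨h₁, -⟩ q₂ ⟨h₂, hint⟩ a b ha hb heq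
  obtain ⟨f, hf⟩ := geometric_hahn_banach_open_point hK.interior isOpen_interior hint
  have hle : ∀ y ∈ K, f y ≤ f ((1 - r) • x + r • q₂) := by
    have hcl : K ⊆ closure (interior K) := by
      rw [hK.closure_interior_eq_closure_of_nonempty_interior ⟨0, h0⟩]
      exact subset_closure
    intro y hy
    exact closure_minimal (fun z hz => (hf z hz).le)
      (isClosed_le f.continuous continuous_const) (hcl hy)
  have hpos := hf 0 h0
  have hx' := hle x hx
  have h1' := hle q₁ h₁
  have h2' := hle q₂ h₂
  have heq' := congrArg f heq
  simp only [map_add, map_sub, map_smul, map_zero, smul_eq_mul] at *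
  have e1 : f x = f q₂ := by nlinarith
  have hpos' : 0 < f q₂ := by rw [e1] at hpos; linarith
  have h1 : 0 ≤ b * (f x - f q₁) := mul_nonneg hb.le (by rw [e1] at h1' ⊢; linarith)
  have h2 : 0 < a * f x := mul_pos ha (by rwa [e1])
  linarith

/-- Every point of a polytope in dimension `n` is in the image of the polytope under a homothety
of ratio `n / (n + 1)` centred at a vertex. -/
theorem exists_homothety_of_mem_convexHull [FiniteDimensional ℝ E] {n : ℕ}
    (hn : Module.finrank ℝ E = n) {V : Set E} {p : E} {r : ℝ} (hr : r = n / (n + 1))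
    (hn0 : 0 < n) (hp : p ∈ convexHull ℝ V) :
    ∃ x ∈ V, ∃ q ∈ convexHull ℝ V, p = (1 - r) • x + r • q := by
  obtain ⟨ι, _, z, w, hz, hind, hw, hsum, rfl⟩ := eq_pos_convex_span_of_mem_convexHull hp
  have hcard : Fintype.card ι ≤ n + 1 := by
    have := hind.card_le_finrank_succ
    have h2 := Submodule.finrank_le (vectorSpan ℝ (range z))
    omega
  have hn' : (0 : ℝ) < n := by exact_mod_cast hn0
  have hr1 : 1 - r = 1 / (n + 1) := by rw [hr]; field_simp; ring
  have hr0 : 0 < r := by rw [hr]; positivity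
  -- Pigeonhole: at most `n + 1` weights sum to 1, and `1 - r = 1 / (n + 1)`.
  obtain ⟨i, hi⟩ : ∃ i, 1 - r ≤ w i := by
    by_contra! hlt
    have hne : (Finset.univ : Finset ι).Nonempty := by
      by_contra hne
      rw [Finset.not_nonempty_iff_eq_empty.1 hne] at hsum
      simp at hsum
    have := Finset.sum_lt_sum_of_nonempty hne fun i _ => hlt i
    rw [hsum, Finset.sum_const, Finset.card_univ, nsmul_eq_mul, hr1, mul_one_div,
      lt_div_iff₀ (by positivity), one_mul] at this
    have : (Fintype.card ι : ℝ) ≤ n + 1 := by exact_mod_cast hcard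
    linarith
  classical
  refine ⟨z i, hz (mem_range_self i),
    ∑ j, ((w j - if j = i then 1 - r else 0) / r) • z j, ?_, ?_⟩
  · refine (convex_convexHull ℝ V).sum_mem (fun j _ => ?_) ?_
      fun j _ => subset_convexHull ℝ V (hz (mem_range_self j))
    · refine div_nonneg ?_ hr0.le
      split_ifs with h
      · rw [h]; linarith
      · linarith [hw j]
    · rw [← Finset.sum_div, Finset.sum_sub_distrib, hsum]
      simp [hr0.ne']
  · rw [Finset.smul_sum]
    simp_rw [smul_smul, mul_div_cancel₀ _ hr0.ne', sub_smul, Finset.sum_sub_distrib, ite_smul,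
      zero_smul]
    simp [sub_smul]

/-- A polytope with the origin in its interior is the union of the wedges at its vertices. -/
theorem convexHull_subset_iUnion_wedge [FiniteDimensional ℝ E] {n : ℕ}
    (hn : Module.finrank ℝ E = n) (hn0 : 0 < n) {V : Set E} (hV : IsCompact (convexHull ℝ V))
    {r : ℝ} (hr : r = n / (n + 1)) {p : E} (hp : p ∈ convexHull ℝ V) (hp0 : p ≠ 0) :
    ∃ x ∈ V, p ∈ wedge r x (chordSet (convexHull ℝ V) r x) := by
  set K := convexHull ℝ V with hK
  -- Radial projection: `s • p` is the last point of `K` on the ray through `p`, hence not interior.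
  obtain ⟨s, ⟨hs₁, hsK⟩, hsmax⟩ : ∃ s, IsGreatest {s : ℝ | 1 ≤ s ∧ s • p ∈ K} s := by
    refine IsCompact.exists_isGreatest ?_ ⟨1, le_rfl, by simpa using hp⟩
    obtain ⟨R, hR⟩ := hV.isBounded.subset_closedBall (0 : E)
    refine isCompact_Icc.of_isClosed_subset (s := Icc 1 (R / ‖p‖)) ?_ ?_
    · have hcont : Continuous fun s : ℝ => s • p := by fun_prop
      exact isClosed_Ici.inter (hV.isClosed.preimage hcont)
    · rintro s ⟨hs, hs'⟩
      have := hR hs'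
      rw [mem_closedBall_zero_iff, norm_smul, Real.norm_of_nonneg (by linarith)] at this
      exact ⟨hs, (le_div_iff₀ (norm_pos_iff.2 hp0)).2 this⟩
  have hs0 : 0 < s := by linarith
  have hint : s • p ∉ interior K := by
    intro hmem
    have hcont : Continuous fun s : ℝ => s • p := by fun_prop
    have hev : ∀ᶠ t in nhds s, t • p ∈ interior K :=
      hcont.continuousAt.eventually (isOpen_interior.mem_nhds hmem)
    obtain ⟨t, ht, hst⟩ := ((hev.filter_mono nhdsWithin_le_nhds).and
      (self_mem_nhdsWithin (s := Ioi s))).exists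
    exact (hsmax ⟨hs₁.trans (le_of_lt hst), interior_subset ht⟩).not_gt hst
  obtain ⟨x, hx, q, hq, heq⟩ := exists_homothety_of_mem_convexHull hn hr hn0 hsK
  refine ⟨x, hx, ⟨s⁻¹, q⟩, ⟨⟨by positivity, inv_le_one_of_one_le₀ hs₁⟩, hq, ?_⟩, ?_⟩
  · rwa [← heq]
  · simp only
    rw [← heq, smul_smul, inv_mul_cancel₀ hs0.ne', one_smul]

end Cover

/-! ### Assembling the linear bound -/

open Set in
theorem zero_mem_interior_convexHull_of_single_mem {n : ℕ} (hn : 0 < n)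
    {V : Set (EuclideanSpace ℝ (Fin n))} (h₁ : ∀ i, EuclideanSpace.single i 1 ∈ V)
    (h₂ : ∀ i, -EuclideanSpace.single i 1 ∈ V) : 0 ∈ interior (convexHull ℝ V) := by
  have hn' : (0 : ℝ) < n := by exact_mod_cast hn
  have hK := convex_convexHull ℝ V
  refine mem_interior.2 ⟨Metric.ball 0 (1 / n), fun p hp => ?_, Metric.isOpen_ball,
    Metric.mem_ball_self (by positivity)⟩
  rw [mem_ball_zero_iff] at hp
  have hcoord : ∀ i, |n * p i| ≤ 1 := by
    intro i
    have h := (PiLp.norm_apply_le p i).trans hp.le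
    rw [Real.norm_eq_abs, le_div_iff₀ hn'] at h
    rw [abs_mul, abs_of_pos hn']
    linarith
  have hmem : ∀ i, (n * p i) • EuclideanSpace.single i (1 : ℝ) ∈ convexHull ℝ V := by
    intro i
    obtain ⟨hl, hu⟩ := abs_le.1 (hcoord i)
    have h := hK (subset_convexHull ℝ V (h₁ i)) (subset_convexHull ℝ V (h₂ i))
      (a := (1 + n * p i) / 2) (b := (1 - n * p i) / 2) (by linarith) (by linarith) (by ring)
    convert h using 1
    module
  have hsum : p = ∑ i : Fin n, (1 / n : ℝ) • ((n * p i) • EuclideanSpace.single i (1 : ℝ)) := by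
    ext j
    simp [Finset.sum_apply, hn'.ne', Pi.single_apply]
  rw [hsum]
  exact hK.sum_mem (fun _ _ => by positivity) (by simp [hn'.ne']) fun i _ => hmem i

theorem hypVolume_ball_half_ne_top (n : ℕ) : hypVolume n (Metric.ball 0 (1 / 2)) ≠ ⊤ := by
  rw [hypVolume_apply measurableSet_ball]
  have hbound : ∀ x ∈ (Metric.ball 0 (1 / 2) ∩ Metric.ball 0 1 : Set (EuclideanSpace ℝ (Fin n))),
      ENNReal.ofReal ((1 - ‖x‖ ^ 2) ^ (-((n + 1 : ℝ) / 2))) ≤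
        ENNReal.ofReal ((3 / 4) ^ (-((n + 1 : ℝ) / 2))) := by
    intro x hx
    have hx' : ‖x‖ < 1 / 2 := by simpa using hx.1
    refine ENNReal.ofReal_le_ofReal (Real.rpow_le_rpow_of_nonpos (by norm_num) ?_ ?_)
    · nlinarith [norm_nonneg x]
    · rw [neg_nonpos]; positivity
  refine ((setLIntegral_mono' (measurableSet_ball.inter measurableSet_ball) hbound).trans_lt ?_).ne
  rw [setLIntegral_const]
  exact ENNReal.mul_lt_top ENNReal.ofReal_lt_top
    ((measure_mono Set.inter_subset_left).trans_lt measure_ball_lt_top)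

/-- A linear bound for polytopes in the closed ball that contain the origin in the interior. -/
theorem exists_hypVolume_convexHull_le {n : ℕ} (hn : 2 ≤ n) :
    ∃ C : ENNReal, C ≠ ⊤ ∧ ∀ V : Finset (EuclideanSpace ℝ (Fin n)),
      (V : Set (EuclideanSpace ℝ (Fin n))) ⊆ Metric.closedBall 0 1 →
      0 ∈ interior (convexHull ℝ (V : Set (EuclideanSpace ℝ (Fin n)))) →
      hypVolume n (convexHull ℝ V) ≤ hypVolume n (Metric.ball 0 (1 / 2)) + V.card * C := by
  -- The hypothesis `2 ≤ n` becomes `1 ≤ m`, which makes both power integrals converge.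
  obtain ⟨m, rfl⟩ : ∃ m, n = m + 1 := ⟨n - 1, by omega⟩
  set r : ℝ := ((m + 1 : ℕ) : ℝ) / ((m + 1 : ℕ) + 1) with hr
  have hr₀ : 0 < r := by positivity
  have hr₁ : r < 1 := by rw [hr, div_lt_one (by positivity)]; linarith
  obtain ⟨C, hC, hwedge⟩ := exists_hypVolume_wedge_le (m := m) (by omega) hr₀ hr₁
  refine ⟨C, hC, fun V hV h0 => ?_⟩
  have hK : IsCompact (convexHull ℝ (V : Set (EuclideanSpace ℝ (Fin (m + 1))))) :=
    V.finite_toSet.isCompact_convexHull (𝕜 := ℝ)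
  have hconv := convex_convexHull ℝ (V : Set (EuclideanSpace ℝ (Fin (m + 1))))
  have hball := convexHull_min hV (convex_closedBall _ _)
  have hcover : convexHull ℝ (V : Set (EuclideanSpace ℝ (Fin (m + 1)))) ⊆ Metric.ball 0 (1 / 2) ∪
      ⋃ x ∈ V, wedge r x (chordSet (convexHull ℝ V) r x) ∩ (Metric.ball 0 (1 / 2))ᶜ := by
    intro p hp
    by_cases hp2 : p ∈ Metric.ball (0 : EuclideanSpace ℝ (Fin (m + 1))) (1 / 2)
    · exact Or.inl hp2
    · have hp0 : p ≠ 0 := by rintro rfl; exact hp2 (Metric.mem_ball_self (by norm_num))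
      obtain ⟨x, hx, hpx⟩ := convexHull_subset_iUnion_wedge (n := m + 1) (by simp) (by omega) hK hr
        hp hp0
      exact Or.inr (Set.mem_biUnion hx ⟨hpx, hp2⟩)
  refine (measure_mono hcover).trans ((measure_union_le _ _).trans ?_)
  gcongr
  refine (measure_biUnion_finset_le _ _).trans ?_
  rw [← nsmul_eq_mul]
  refine Finset.sum_le_card_nsmul _ _ _ fun x hx => ?_
  exact hwedge x _ (by simpa using hV hx) (hK.chordSet r x) ((Set.sep_subset _ _).trans hball)
    (hconv.nonCrossing_chordSet h0 hr₀ hr₁ (subset_convexHull ℝ _ hx))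

theorem theorem1 (n : ℕ) (hn : 2 ≤ n) :
    ∃ C : ℝ, 0 < C ∧
      ∀ N : ℕ, 1 ≤ N →
        ∀ x : Fin N → EuclideanSpace ℝ (Fin n), (∀ i, x i ∈ kleinClosedBall n) →
          hypVolume n (hypConvexHull (Set.range x)) < ENNReal.ofReal (C * N) := by
  classical
  obtain ⟨C, hC, hbound⟩ := exists_hypVolume_convexHull_le hn
  have hD := hypVolume_ball_half_ne_top n
  set D := hypVolume n (Metric.ball 0 (1 / 2))
  -- Since `1 ≤ N`, `N + 2 * n ≤ (1 + 2 * n) * N`; the final `+ 1` gives strictness.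
  refine ⟨D.toReal + (1 + 2 * n) * C.toReal + 1, by positivity, fun N hN x hx => ?_⟩
  let e : Fin n → EuclideanSpace ℝ (Fin n) := fun i => EuclideanSpace.single i 1
  let V : Finset (EuclideanSpace ℝ (Fin n)) :=
    Finset.univ.image x ∪ (Finset.univ.image e ∪ Finset.univ.image (-e))
  have hcard : V.card ≤ N + 2 * n := by
    have h1 := Finset.card_union_le (Finset.univ.image x)
      (Finset.univ.image e ∪ Finset.univ.image (-e))
    have h2 := Finset.card_union_le (Finset.univ.image e) (Finset.univ.image (-e))
    have h3 := Finset.card_image_le (s := Finset.univ) (f := x)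
    have h4 := Finset.card_image_le (s := Finset.univ) (f := e)
    have h5 := Finset.card_image_le (s := Finset.univ) (f := -e)
    simp only [Finset.card_univ, Fintype.card_fin] at h3 h4 h5
    change (Finset.univ.image x ∪ (Finset.univ.image e ∪ Finset.univ.image (-e))).card ≤ _
    omega
  have hVball : (V : Set (EuclideanSpace ℝ (Fin n))) ⊆ Metric.closedBall 0 1 := by
    intro v hv
    simp only [V, Finset.coe_union, Finset.coe_image, Finset.coe_univ, Set.image_univ,
      Set.mem_union, Set.mem_range] at hv
    rcases hv with ⟨i, rfl⟩ | ⟨i, rfl⟩ | ⟨i, rfl⟩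
    · exact hx i
    · simp [e]
    · simp [e]
  have hxV : Set.range x ⊆ V := by rintro _ ⟨i, rfl⟩; simp [V]
  have h0 : 0 ∈ interior (convexHull ℝ (V : Set (EuclideanSpace ℝ (Fin n)))) := by
    refine zero_mem_interior_convexHull_of_single_mem (by omega) (fun i => ?_) fun i => ?_
    · exact Finset.mem_coe.2 (Finset.mem_union_right _ (Finset.mem_union_left _
        (Finset.mem_image_of_mem e (Finset.mem_univ i))))
    · exact Finset.mem_coe.2 (Finset.mem_union_right _ (Finset.mem_union_right _
        (Finset.mem_image_of_mem (-e) (Finset.mem_univ i))))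
  have hhull : hypConvexHull (Set.range x) ⊆ convexHull ℝ V :=
    (hypConvexHull_subset_convexHull (by rintro _ ⟨i, rfl⟩; exact hx i)).trans (convexHull_mono hxV)
  have hN' : (1 : ℝ) ≤ N := by exact_mod_cast hN
  have hcard' : (V.card : ℝ) ≤ N + 2 * n := by exact_mod_cast hcard
  calc hypVolume n (hypConvexHull (Set.range x)) ≤ D + V.card * C :=
        (measure_mono hhull).trans (hbound V hVball h0)
    _ = ENNReal.ofReal (D.toReal + V.card * C.toReal) := by
        rw [ENNReal.ofReal_add (by positivity) (by positivity), ENNReal.ofReal_mul (by positivity),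
          ENNReal.ofReal_natCast, ENNReal.ofReal_toReal hD, ENNReal.ofReal_toReal hC]
    _ < _ := by
        rw [ENNReal.ofReal_lt_ofReal_iff (by positivity)]
        have h1 : V.card * C.toReal ≤ (N + 2 * n) * C.toReal := by gcongr
        have h2 : D.toReal ≤ D.toReal * N := le_mul_of_one_le_right (by positivity) hN'
        have h3 : 2 * n * C.toReal ≤ 2 * n * C.toReal * N :=
          le_mul_of_one_le_right (by positivity) hN'
        linarith
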